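/- Let $h_1,\dots,h_{K_I}\in\mathbb C^{1\times M}$ and $g_1,\dots,g_{K_E}\in\mathbb C^{1\times M}$ be row vectors, let $\sigma_i>0$ and $\gamma_i>0$ $(1\le i\le K_I)$, $\alpha_j\ge 0$ $(1\le j\le K_E)$, $0<\zeta\le 1$ and $\beta\ge 0$, and put $G=\zeta\sum_{j}\alpha_j g_j^Hg_j$. Let $g(\beta)\in[-\infty,+\infty]$ be the infimum of $\sum_{i} w_i^H(\beta I-G)w_i$ over all $w_1,\dots,w_{K_I}\in\mathbb C^{M}$ with $$\frac{|h_iw_i|^2}{\sum_{k\ne i}|h_iw_k|^2+\sigma_i^2}\ \ge\ \gamma_i\qquad\text{for all } i .$$ For $\lambda\in\mathbb R^{K_I}$ write $A_i(\lambda)=\sum_{k\neq i}\lambda_k h_k^Hh_k+\beta I-G$ and $$m_i(\lambda)=\min_{\|w\|=1,\ h_iw\ne 0}\ \gamma_i\,\frac{w^HA_i(\lambda)w}{w^Hh_i^Hh_iw}.$$ Let $\lambda^{(0)}$ be any feasible power vector of the dual uplink problem, that is, $\lambda^{(0)}_i\ge 0$ for all $i$ and there are $\tilde w_1,\dots,\tilde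 w_{K_I}\in\mathbb C^M$ with $$\frac{\lambda^{(0)}_i\,\tilde w_i^Hh_i^Hh_i\tilde w_i}{\tilde w_i^HA_i(\lambda^{(0)})\tilde w_i}\ \ge\ \gamma_i\qquad\text{for all } i$$ (all denominators being nonzero), and let $\lambda^{(n+1)}_i=m_i(\lambda^{(n)})$ be the fixed-point iteration started at $\lambda^{(0)}$. **Proposition.** Suppose that $\beta I-G$ is not positive semidefinite and $g(\beta)=-\infty$. Then after finitely many steps the iteration reaches a point $\lambda^{(n)}$, $n\ge 0$, such that $$\sum_{k\ne i}\lambda_k^{(n)}h_k^Hh_k+\beta I-G\ \text{ is not positive semidefinite for some } i .$$ For the first such $n$, the iterates up to $\lambda^{(n)}$ are well defined: for every $m<n$ and every $i$ the minimum defining $m_i(\lambda^{(m)})$ exists and is attained. -/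

import Mathlib

open scoped ComplexOrder

noncomputable section

/-- The matrix `h^H h` of a channel row vector `h ∈ ℂ^{1×M}`; its `(a, b)` entry is
`conj (h a) * h b`. -/
def channelGram {M : ℕ} (h : Fin M → ℂ) : Matrix (Fin M) (Fin M) ℂ :=
  Matrix.vecMulVec (star h) h

/-- The Hermitian form `w^H A w` (its real part, which is all of it for Hermitian `A`). -/
def hermForm {M : ℕ} (A : Matrix (Fin M) (Fin M) ℂ) (w : Fin M → ℂ) : ℝ :=
  (star w ⬝ᵥ A.mulVec w).re

/-- The energy matrix `G = ζ ∑_j α_j g_j^H g_j` of the energy receivers. -/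
def energyMatrix {M KE : ℕ} (ζ : ℝ) (α : Fin KE → ℝ) (g : Fin KE → Fin M → ℂ) :
    Matrix (Fin M) (Fin M) ℂ :=
  (ζ : ℂ) • ∑ j, (α j : ℂ) • channelGram (g j)

/-- The (possibly indefinite) matrix `β I - G`. -/
def noiseMatrix {M : ℕ} (β : ℝ) (G : Matrix (Fin M) (Fin M) ℂ) : Matrix (Fin M) (Fin M) ℂ :=
  (β : ℂ) • (1 : Matrix (Fin M) (Fin M) ℂ) - G

/-- The downlink SINR of information receiver `i` under the beamforming vectors `w`. -/
def downlinkSINR {M KI : ℕ} (h : Fin KI → Fin M → ℂ) (σ : Fin KI → ℝ)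
    (w : Fin KI → Fin M → ℂ) (i : Fin KI) : ℝ :=
  ‖h i ⬝ᵥ w i‖ ^ 2 / (∑ k ∈ Finset.univ.erase i, ‖h i ⬝ᵥ w k‖ ^ 2 + σ i ^ 2)

/-- `g(β)`: the infimum of `∑_i w_i^H (β I - G) w_i` over all beamforming vectors that meet the
downlink SINR targets, as an extended real (`⊥ = -∞` when the problem is unbounded from below,
`⊤ = +∞` when it is infeasible). -/
def downlinkValue {M KI : ℕ} (h : Fin KI → Fin M → ℂ) (σ γ : Fin KI → ℝ)
    (G : Matrix (Fin M) (Fin M) ℂ) (β : ℝ) : EReal :=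
  ⨅ w ∈ {w : Fin KI → Fin M → ℂ | ∀ i, γ i ≤ downlinkSINR h σ w i},
    ((∑ i, hermForm (noiseMatrix β G) (w i) : ℝ) : EReal)

/-- `∑_{k ≠ i} lam_k h_k^H h_k + β I - G`, the interference-plus-noise matrix seen by user `i` in
the dual uplink. -/
def uplinkMatrix {M KI : ℕ} (h : Fin KI → Fin M → ℂ) (G : Matrix (Fin M) (Fin M) ℂ) (β : ℝ)
    (lam : Fin KI → ℝ) (i : Fin KI) : Matrix (Fin M) (Fin M) ℂ :=
  ∑ k ∈ Finset.univ.erase i, (lam k : ℂ) • channelGram (h k) + noiseMatrix β G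

/-- The uplink SINR of user `i` with receive vector `w` and powers `lam`. -/
def uplinkSINR {M KI : ℕ} (h : Fin KI → Fin M → ℂ) (G : Matrix (Fin M) (Fin M) ℂ) (β : ℝ)
    (lam : Fin KI → ℝ) (i : Fin KI) (w : Fin M → ℂ) : ℝ :=
  lam i * hermForm (channelGram (h i)) w / hermForm (uplinkMatrix h G β lam i) w

/-- `lam` is a feasible power vector of the dual uplink problem: it is nonnegative and, with some
receive vectors, meets all SINR targets. For positive targets a receive vector at which the
denominator of the SINR is not positive never meets its target. -/
def UplinkFeasible {M KI : ℕ} (h : Fin KI → Fin M → ℂ) (γ : Fin KI → ℝ)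
    (G : Matrix (Fin M) (Fin M) ℂ) (β : ℝ) (lam : Fin KI → ℝ) : Prop :=
  (∀ i, 0 ≤ lam i) ∧ ∃ w : Fin KI → Fin M → ℂ, ∀ i, γ i ≤ uplinkSINR h G β lam i (w i)

/-- The values `γ_i (w^H (∑_{k ≠ i} lam_k h_k^H h_k + β I - G) w) / (w^H h_i^H h_i w)` over the
Euclidean unit vectors `w` at which the quotient is defined, i.e. `h_i w ≠ 0`. -/
def updateValues {M KI : ℕ} (h : Fin KI → Fin M → ℂ) (γ : Fin KI → ℝ)
    (G : Matrix (Fin M) (Fin M) ℂ) (β : ℝ) (lam : Fin KI → ℝ) (i : Fin KI) : Set ℝ :=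
  {r | ∃ w : Fin M → ℂ, ∑ a, ‖w a‖ ^ 2 = 1 ∧ h i ⬝ᵥ w ≠ 0 ∧
    r = γ i * (hermForm (uplinkMatrix h G β lam i) w / hermForm (channelGram (h i)) w)}

/-- The update map `m = (m_i)_i`, where `m_i(lam)` is the least element of `updateValues`. -/
def updateMap {M KI : ℕ} (h : Fin KI → Fin M → ℂ) (γ : Fin KI → ℝ)
    (G : Matrix (Fin M) (Fin M) ℂ) (β : ℝ) (lam : Fin KI → ℝ) : Fin KI → ℝ :=
  fun i => sInf (updateValues h γ G β lam i)

/-- The fixed-point iteration `lam^(0) = lam0`, `lam^(n+1) = m(lam^(n))`. -/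
def fixedPointIter {M KI : ℕ} (h : Fin KI → Fin M → ℂ) (γ : Fin KI → ℝ)
    (G : Matrix (Fin M) (Fin M) ℂ) (β : ℝ) (lam0 : Fin KI → ℝ) : ℕ → Fin KI → ℝ
  | 0 => lam0
  | n + 1 => updateMap h γ G β (fixedPointIter h γ G β lam0 n)

end

/-!
While the matrices `A_i(lam) = ∑_{k ≠ i} lam_k h_k^H h_k + β I - G` are positive semidefinite, the
update `m_i(lam)` is the largest `c` for which `γ_i A_i(lam) - c h_i^H h_i` is positive
semidefinite. Hence `m` is monotone, and uplink feasibility of `lam^(0)` gives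
`m(lam^(0)) ≤ lam^(0)`. If the iteration never left the positive semidefinite region, it would
therefore decrease to a limit `mu` with `γ_i A_i(mu) - mu_i h_i^H h_i` positive semidefinite for
all `i`. Such a `mu` is feasible for the Lagrangian dual of the downlink problem, so weak duality
would give `g(β) ≥ 0`.

The minimum defining `m_i(lam)` is attained because, after the normalization `h_i w = 1`, it is the
squared distance from a point to a subspace of a finite-dimensional space, times `γ_i`.
-/

section LinearMap

variable {𝕜 E F W : Type*} [RCLike 𝕜] [AddCommGroup E] [Module 𝕜 E] [NormedAddCommGroup F]
  [NormedSpace 𝕜 F] [FiniteDimensional 𝕜 F] [AddCommGroup W] [Module 𝕜 W]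

theorem exists_isMinOn_norm_fiber (L : E →ₗ[𝕜] F) (f : E →ₗ[𝕜] W) {c : W}
    (hc : c ∈ Set.range f) : ∃ w₀ ∈ f ⁻¹' {c}, IsMinOn (fun w => ‖L w‖) (f ⁻¹' {c}) w₀ := by
  obtain ⟨u, rfl⟩ := hc
  have := FiniteDimensional.proper_rclike 𝕜 F
  let K : Submodule 𝕜 F := (LinearMap.ker f).map L
  obtain ⟨_, ⟨x, hx : f x = 0, rfl⟩, hdist⟩ :=
    K.closed_of_finiteDimensional.exists_infDist_eq_dist K.nonempty (L u)
  refine ⟨u - x, by simp [hx], fun w (hw : f w = f u) => ?_⟩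
  have hmem : L (u - w) ∈ K := Submodule.mem_map_of_mem (by simp [hw])
  calc ‖L (u - x)‖ = dist (L u) (L x) := by rw [map_sub, dist_eq_norm]
    _ ≤ dist (L u) (L (u - w)) := hdist ▸ Metric.infDist_le_dist_of_mem hmem
    _ = ‖L w‖ := by rw [dist_eq_norm, ← map_sub, sub_sub_cancel]

end LinearMap

theorem exists_smul_sum_norm_sq_eq_one {𝕜 ι : Type*} [RCLike 𝕜] [Fintype ι] {w : ι → 𝕜}
    (hw : w ≠ 0) : ∃ c : 𝕜, c ≠ 0 ∧ ∑ a, ‖(c • w) a‖ ^ 2 = 1 := by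
  have hw' : WithLp.toLp 2 w ≠ 0 := (WithLp.toLp_eq_zero 2).not.mpr hw
  refine ⟨(‖WithLp.toLp 2 w‖⁻¹ : 𝕜), by simpa using hw, ?_⟩
  rw [← EuclideanSpace.norm_sq_eq (WithLp.toLp 2 _), WithLp.toLp_smul, norm_smul_inv_norm hw',
    one_pow]

section HermForm

variable {M : ℕ} {A : Matrix (Fin M) (Fin M) ℂ}

theorem hermForm_nonneg (hA : A.PosSemidef) (w : Fin M → ℂ) : 0 ≤ hermForm A w :=
  hA.re_dotProduct_nonneg w

theorem hermForm_smul_right (A : Matrix (Fin M) (Fin M) ℂ) (c : ℂ) (w : Fin M → ℂ) :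
    hermForm A (c • w) = ‖c‖ ^ 2 * hermForm A w := by
  have hc : star c * c = ((‖c‖ ^ 2 : ℝ) : ℂ) := by
    rw [Complex.ofReal_pow]
    exact Complex.conj_mul' c
  rw [hermForm, Matrix.mulVec_smul, star_smul, smul_dotProduct, dotProduct_smul, smul_smul, hc,
    smul_eq_mul, Complex.re_ofReal_mul, hermForm]

theorem hermForm_add_left (A B : Matrix (Fin M) (Fin M) ℂ) (w : Fin M → ℂ) :
    hermForm (A + B) w = hermForm A w + hermForm B w := by
  simp [hermForm, Matrix.add_mulVec, dotProduct_add]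

theorem hermForm_ofReal_smul_left (c : ℝ) (A : Matrix (Fin M) (Fin M) ℂ) (w : Fin M → ℂ) :
    hermForm ((c : ℂ) • A) w = c * hermForm A w := by
  simp [hermForm, Matrix.smul_mulVec, dotProduct_smul]

theorem hermForm_sum_left {ι : Type*} (s : Finset ι) (A : ι → Matrix (Fin M) (Fin M) ℂ)
    (w : Fin M → ℂ) : hermForm (∑ k ∈ s, A k) w = ∑ k ∈ s, hermForm (A k) w := by
  simp [hermForm, Matrix.sum_mulVec, dotProduct_sum]

theorem hermForm_conjTranspose_mul_self {ι : Type*} [Fintype ι] (B : Matrix ι (Fin M) ℂ)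
    (w : Fin M → ℂ) :
    hermForm (B.conjTranspose * B) w = ‖Matrix.toLpLin 2 2 B (WithLp.toLp 2 w)‖ ^ 2 := by
  rw [← inner_self_eq_norm_sq (𝕜 := ℂ), Matrix.toLpLin_toLp, EuclideanSpace.inner_toLp_toLp,
    hermForm, ← Matrix.mulVec_mulVec, Matrix.dotProduct_mulVec, Matrix.vecMul_conjTranspose,
    star_star, dotProduct_comm]
  rfl

theorem hermForm_channelGram (h w : Fin M → ℂ) : hermForm (channelGram h) w = ‖h ⬝ᵥ w‖ ^ 2 := by
  have hstar : star w ⬝ᵥ star h = star (h ⬝ᵥ w) := by rw [← Matrix.star_dotProduct_star]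
  rw [hermForm, channelGram, Matrix.vecMulVec_mulVec, dotProduct_smul, hstar,
    op_smul_eq_mul, RCLike.star_def, Complex.conj_mul', ← Complex.ofReal_pow, Complex.ofReal_re]

theorem exists_isMinOn_hermForm_fiber {W : Type*} [AddCommGroup W] [Module ℂ W]
    (hA : A.PosSemidef) (f : (Fin M → ℂ) →ₗ[ℂ] W) {c : W} (hc : c ∈ Set.range f) :
    ∃ w₀ ∈ f ⁻¹' {c}, IsMinOn (hermForm A) (f ⁻¹' {c}) w₀ := by
  obtain ⟨B, rfl⟩ : ∃ B : Matrix (Fin M) (Fin M) ℂ, A = B.conjTranspose * B := by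
    open scoped MatrixOrder in
    exact CStarAlgebra.nonneg_iff_eq_star_mul_self.mp hA.nonneg
  obtain ⟨w₀, hw₀, hmin⟩ := exists_isMinOn_norm_fiber
    (Matrix.toLpLin 2 2 B ∘ₗ (WithLp.linearEquiv 2 ℂ (Fin M → ℂ)).symm.toLinearMap) f hc
  refine ⟨w₀, hw₀, fun w hw => ?_⟩
  simp only [Set.mem_ofPred_eq, hermForm_conjTranspose_mul_self]
  exact pow_le_pow_left₀ (norm_nonneg _) (hmin hw) 2

theorem exists_isMinOn_hermForm_hyperplane (hA : A.PosSemidef) {h : Fin M → ℂ} (hh : h ≠ 0) :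
    ∃ w₀ ∈ {w | h ⬝ᵥ w = 1}, IsMinOn (hermForm A) {w | h ⬝ᵥ w = 1} w₀ := by
  obtain ⟨v, hv⟩ : ∃ v, h ⬝ᵥ v ≠ 0 := by
    simpa only [ne_eq, not_forall] using mt (dotProduct_eq_zero h) hh
  exact exists_isMinOn_hermForm_fiber hA (dotProductBilin ℂ ℂ h)
    ⟨(h ⬝ᵥ v)⁻¹ • v, by simp [hv]⟩

end HermForm

section UpdateMap

variable {M KI : ℕ} {h : Fin KI → Fin M → ℂ} {γ : Fin KI → ℝ} {G : Matrix (Fin M) (Fin M) ℂ}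
  {β : ℝ} {lam mu : Fin KI → ℝ} {i : Fin KI}

theorem hermForm_uplinkMatrix (h : Fin KI → Fin M → ℂ) (G : Matrix (Fin M) (Fin M) ℂ) (β : ℝ)
    (lam : Fin KI → ℝ) (i : Fin KI) (w : Fin M → ℂ) :
    hermForm (uplinkMatrix h G β lam i) w =
      ∑ k ∈ Finset.univ.erase i, lam k * ‖h k ⬝ᵥ w‖ ^ 2 + hermForm (noiseMatrix β G) w := by
  simp only [uplinkMatrix, hermForm_add_left, hermForm_sum_left, hermForm_ofReal_smul_left,
    hermForm_channelGram]

theorem hermForm_uplinkMatrix_mono (hle : lam ≤ mu) (w : Fin M → ℂ) :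
    hermForm (uplinkMatrix h G β lam i) w ≤ hermForm (uplinkMatrix h G β mu i) w := by
  simp only [hermForm_uplinkMatrix]
  gcongr with k
  exact hle k

theorem continuous_hermForm_uplinkMatrix (h : Fin KI → Fin M → ℂ) (G : Matrix (Fin M) (Fin M) ℂ)
    (β : ℝ) (i : Fin KI) (w : Fin M → ℂ) :
    Continuous fun lam => hermForm (uplinkMatrix h G β lam i) w := by
  simp only [hermForm_uplinkMatrix]
  fun_prop

theorem updateValues_eq_image :
    updateValues h γ G β lam i =
      (fun w => γ i * hermForm (uplinkMatrix h G β lam i) w) '' {w | h i ⬝ᵥ w = 1} := by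
  ext r
  constructor
  · rintro ⟨w, -, hw, rfl⟩
    refine ⟨(h i ⬝ᵥ w)⁻¹ • w, by simp [hw], ?_⟩
    simp only [hermForm_smul_right, hermForm_channelGram, norm_inv, inv_pow, div_eq_inv_mul]
  · rintro ⟨w, hw : h i ⬝ᵥ w = 1, rfl⟩
    obtain ⟨c, hc, hunit⟩ := exists_smul_sum_norm_sq_eq_one (w := w) (by rintro rfl; simp at hw)
    have hcw : h i ⬝ᵥ (c • w) = c := by rw [dotProduct_smul, hw, smul_eq_mul, mul_one]
    refine ⟨c • w, hunit, by rwa [hcw], ?_⟩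
    rw [hermForm_channelGram, hcw, hermForm_smul_right, mul_div_cancel_left₀ _ (by positivity)]

theorem isLeast_updateMap (hγ : 0 ≤ γ i) (hpos : (uplinkMatrix h G β lam i).PosSemidef)
    (hh : h i ≠ 0) : IsLeast (updateValues h γ G β lam i) (updateMap h γ G β lam i) := by
  obtain ⟨w₀, hw₀, hmin⟩ := exists_isMinOn_hermForm_hyperplane hpos hh
  have hleast : IsLeast (updateValues h γ G β lam i)
      (γ i * hermForm (uplinkMatrix h G β lam i) w₀) := by
    rw [updateValues_eq_image]
    refine ⟨⟨w₀, hw₀, rfl⟩, ?_⟩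
    rintro _ ⟨w, hw, rfl⟩
    exact mul_le_mul_of_nonneg_left (hmin hw) hγ
  rwa [updateMap, hleast.csInf_eq]

theorem le_updateMap_iff (hγ : 0 ≤ γ i) (hpos : (uplinkMatrix h G β lam i).PosSemidef)
    (hh : h i ≠ 0) {c : ℝ} :
    c ≤ updateMap h γ G β lam i ↔
      ∀ w, c * ‖h i ⬝ᵥ w‖ ^ 2 ≤ γ i * hermForm (uplinkMatrix h G β lam i) w := by
  rw [le_isGLB_iff (isLeast_updateMap hγ hpos hh).isGLB, updateValues_eq_image,
    mem_lowerBounds, Set.forall_mem_image]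
  refine ⟨fun hle w => ?_, fun hle w (hw : h i ⬝ᵥ w = 1) => by simpa [hw] using hle w⟩
  by_cases hw : h i ⬝ᵥ w = 0
  · simpa [hw] using mul_nonneg hγ (hermForm_nonneg hpos w)
  · have hnormalized : c ≤ γ i * hermForm (uplinkMatrix h G β lam i) ((h i ⬝ᵥ w)⁻¹ • w) :=
      hle (by simp [hw])
    rwa [hermForm_smul_right, norm_inv, inv_pow, ← div_eq_inv_mul, ← mul_div_assoc,
      le_div_iff₀ (by positivity)] at hnormalized

theorem updateMap_mul_le (hγ : 0 ≤ γ i) (hpos : (uplinkMatrix h G β lam i).PosSemidef)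
    (hh : h i ≠ 0) (w : Fin M → ℂ) :
    updateMap h γ G β lam i * ‖h i ⬝ᵥ w‖ ^ 2 ≤ γ i * hermForm (uplinkMatrix h G β lam i) w :=
  (le_updateMap_iff hγ hpos hh).mp le_rfl w

theorem updateMap_nonneg (hγ : 0 ≤ γ i) (hpos : (uplinkMatrix h G β lam i).PosSemidef)
    (hh : h i ≠ 0) : 0 ≤ updateMap h γ G β lam i :=
  (le_updateMap_iff hγ hpos hh).mpr fun w => by
    simpa using mul_nonneg hγ (hermForm_nonneg hpos w)

theorem updateMap_mono (hγ : 0 ≤ γ i) (hlam : (uplinkMatrix h G β lam i).PosSemidef)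
    (hmu : (uplinkMatrix h G β mu i).PosSemidef) (hh : h i ≠ 0) (hle : lam ≤ mu) :
    updateMap h γ G β lam i ≤ updateMap h γ G β mu i :=
  (le_updateMap_iff hγ hmu hh).mpr fun w => (updateMap_mul_le hγ hlam hh w).trans <|
    mul_le_mul_of_nonneg_left (hermForm_uplinkMatrix_mono hle w) hγ

end UpdateMap

section Iteration

variable {M KI : ℕ} {h : Fin KI → Fin M → ℂ} {γ : Fin KI → ℝ} {G : Matrix (Fin M) (Fin M) ℂ}
  {β : ℝ} {lam : Fin KI → ℝ} {i : Fin KI}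

theorem UplinkFeasible.exists_mul_hermForm_le (hlam : UplinkFeasible h γ G β lam) (hγ : 0 < γ i) :
    ∃ w, h i ⬝ᵥ w ≠ 0 ∧
      γ i * hermForm (uplinkMatrix h G β lam i) w ≤ lam i * ‖h i ⬝ᵥ w‖ ^ 2 := by
  obtain ⟨hnonneg, w, hw⟩ := hlam
  have hquot : 0 < lam i * ‖h i ⬝ᵥ w i‖ ^ 2 / hermForm (uplinkMatrix h G β lam i) (w i) := by
    simpa only [uplinkSINR, hermForm_channelGram] using hγ.trans_le (hw i)
  have hnum : 0 ≤ lam i * ‖h i ⬝ᵥ w i‖ ^ 2 := mul_nonneg (hnonneg i) (sq_nonneg _)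
  have hden : 0 < hermForm (uplinkMatrix h G β lam i) (w i) := by
    by_contra! hneg
    exact hquot.not_ge (div_nonpos_of_nonneg_of_nonpos hnum hneg)
  refine ⟨w i, fun hzero => by simp [hzero] at hquot, ?_⟩
  simpa only [uplinkSINR, hermForm_channelGram, le_div_iff₀ hden] using hw i

theorem UplinkFeasible.channel_ne_zero (hlam : UplinkFeasible h γ G β lam) (hγ : 0 < γ i) :
    h i ≠ 0 := by
  obtain ⟨w, hw, -⟩ := hlam.exists_mul_hermForm_le hγ
  intro hzero
  exact hw (by rw [hzero, zero_dotProduct])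

theorem UplinkFeasible.updateMap_le (hlam : UplinkFeasible h γ G β lam) (hγ : 0 < γ i)
    (hpos : (uplinkMatrix h G β lam i).PosSemidef) : updateMap h γ G β lam i ≤ lam i := by
  obtain ⟨w, hw, hle⟩ := hlam.exists_mul_hermForm_le hγ
  refine le_of_mul_le_mul_right ?_ (pow_pos (norm_pos_iff.mpr hw) 2)
  exact (updateMap_mul_le hγ.le hpos (hlam.channel_ne_zero hγ) w).trans hle

theorem UplinkFeasible.fixedPointIter_nonneg (hlam : UplinkFeasible h γ G β lam)
    (hγ : ∀ i, 0 < γ i)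
    (hpos : ∀ n i, (uplinkMatrix h G β (fixedPointIter h γ G β lam n) i).PosSemidef) :
    ∀ n, 0 ≤ fixedPointIter h γ G β lam n
  | 0 => hlam.1
  | n + 1 => fun i => updateMap_nonneg (hγ i).le (hpos n i) (hlam.channel_ne_zero (hγ i))

theorem UplinkFeasible.antitone_fixedPointIter (hlam : UplinkFeasible h γ G β lam)
    (hγ : ∀ i, 0 < γ i)
    (hpos : ∀ n i, (uplinkMatrix h G β (fixedPointIter h γ G β lam n) i).PosSemidef) :
    Antitone (fixedPointIter h γ G β lam) := by
  refine antitone_nat_of_succ_le fun n => ?_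
  induction n with
  | zero => exact fun i => hlam.updateMap_le (hγ i) (hpos 0 i)
  | succ n ih =>
    exact fun i => updateMap_mono (hγ i).le (hpos (n + 1) i) (hpos n i)
      (hlam.channel_ne_zero (hγ i)) ih

end Iteration

/-- Feasibility of the multipliers `mu` in the Lagrangian dual of the downlink problem: `mu` is
nonnegative and `γ_i (∑_{k ≠ i} mu_k h_k^H h_k + β I - G) - mu_i h_i^H h_i` is positive semidefinite
for every `i`. The matrix inequality is stated through its quadratic form. -/
def DualFeasible {M KI : ℕ} (h : Fin KI → Fin M → ℂ) (γ : Fin KI → ℝ)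
    (G : Matrix (Fin M) (Fin M) ℂ) (β : ℝ) (mu : Fin KI → ℝ) : Prop :=
  (∀ i, 0 ≤ mu i) ∧
    ∀ i w, mu i * ‖h i ⬝ᵥ w‖ ^ 2 ≤ γ i * hermForm (uplinkMatrix h G β mu i) w

section Duality

variable {M KI : ℕ} {h : Fin KI → Fin M → ℂ} {γ σ : Fin KI → ℝ} {G : Matrix (Fin M) (Fin M) ℂ}
  {β : ℝ} {lam mu : Fin KI → ℝ} {i : Fin KI}

theorem UplinkFeasible.exists_dualFeasible (hlam : UplinkFeasible h γ G β lam)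
    (hγ : ∀ i, 0 < γ i)
    (hpos : ∀ n i, (uplinkMatrix h G β (fixedPointIter h γ G β lam n) i).PosSemidef) :
    ∃ mu, DualFeasible h γ G β mu := by
  have hnonneg := hlam.fixedPointIter_nonneg hγ hpos
  have hlim := tendsto_atTop_ciInf (hlam.antitone_fixedPointIter hγ hpos)
    ⟨0, Set.forall_mem_range.mpr hnonneg⟩
  refine ⟨⨅ n, fixedPointIter h γ G β lam n, ge_of_tendsto' hlim hnonneg, fun i w => ?_⟩
  have hlim_succ := (tendsto_pi_nhds.mp hlim i).comp (Filter.tendsto_add_atTop_nat 1)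
  have hlim_form := ((continuous_hermForm_uplinkMatrix h G β i w).tendsto _).comp hlim
  exact le_of_tendsto_of_tendsto' (hlim_succ.mul_const _) (hlim_form.const_mul _) fun n =>
    updateMap_mul_le (hγ i).le (hpos n i) (hlam.channel_ne_zero (hγ i)) w

theorem mul_interference_le_of_le_downlinkSINR {w : Fin KI → Fin M → ℂ} (hγ : 0 ≤ γ i)
    (hw : γ i ≤ downlinkSINR h σ w i) :
    γ i * ∑ k ∈ Finset.univ.erase i, ‖h i ⬝ᵥ w k‖ ^ 2 ≤ ‖h i ⬝ᵥ w i‖ ^ 2 :=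
  calc γ i * ∑ k ∈ Finset.univ.erase i, ‖h i ⬝ᵥ w k‖ ^ 2
    _ ≤ γ i * (∑ k ∈ Finset.univ.erase i, ‖h i ⬝ᵥ w k‖ ^ 2 + σ i ^ 2) := by
      gcongr
      exact le_add_of_nonneg_right (sq_nonneg _)
    _ ≤ ‖h i ⬝ᵥ w i‖ ^ 2 := mul_le_of_le_div₀ (by positivity) (by positivity) hw

theorem DualFeasible.sum_hermForm_noiseMatrix_nonneg (hmu : DualFeasible h γ G β mu)
    (hγ : ∀ i, 0 < γ i) {w : Fin KI → Fin M → ℂ} (hw : ∀ i, γ i ≤ downlinkSINR h σ w i) :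
    0 ≤ ∑ i, hermForm (noiseMatrix β G) (w i) := by
  obtain ⟨hnonneg, hform⟩ := hmu
  have hinterference : ∑ i, mu i * ∑ k ∈ Finset.univ.erase i, ‖h i ⬝ᵥ w k‖ ^ 2 =
      ∑ i, ∑ k ∈ Finset.univ.erase i, mu k * ‖h k ⬝ᵥ w i‖ ^ 2 := by
    simp only [Finset.mul_sum]
    exact Finset.sum_comm' (by simp [ne_comm])
  have huser (i : Fin KI) : mu i * ∑ k ∈ Finset.univ.erase i, ‖h i ⬝ᵥ w k‖ ^ 2 ≤
      hermForm (uplinkMatrix h G β mu i) (w i) := by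
    refine le_of_mul_le_mul_left ?_ (hγ i)
    calc γ i * (mu i * ∑ k ∈ Finset.univ.erase i, ‖h i ⬝ᵥ w k‖ ^ 2)
      _ = mu i * (γ i * ∑ k ∈ Finset.univ.erase i, ‖h i ⬝ᵥ w k‖ ^ 2) := mul_left_comm _ _ _
      _ ≤ mu i * ‖h i ⬝ᵥ w i‖ ^ 2 := mul_le_mul_of_nonneg_left
          (mul_interference_le_of_le_downlinkSINR (hγ i).le (hw i)) (hnonneg i)
      _ ≤ γ i * hermForm (uplinkMatrix h G β mu i) (w i) := hform i (w i)
  have htotal := Finset.sum_le_sum fun i (_ : i ∈ Finset.univ) => huser i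
  simp only [hermForm_uplinkMatrix, Finset.sum_add_distrib] at htotal
  rwa [hinterference, le_add_iff_nonneg_right] at htotal

theorem DualFeasible.downlinkValue_nonneg (hmu : DualFeasible h γ G β mu) (hγ : ∀ i, 0 < γ i) :
    0 ≤ downlinkValue h σ γ G β :=
  le_iInf₂ fun _ hw => EReal.coe_nonneg.mpr (hmu.sum_hermForm_noiseMatrix_nonneg hγ hw)

theorem UplinkFeasible.exists_not_posSemidef (hlam : UplinkFeasible h γ G β lam)
    (hγ : ∀ i, 0 < γ i) (hunb : downlinkValue h σ γ G β = ⊥) :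
    ∃ n i, ¬ (uplinkMatrix h G β (fixedPointIter h γ G β lam n) i).PosSemidef := by
  by_contra! hpos
  obtain ⟨mu, hmu⟩ := hlam.exists_dualFeasible hγ hpos
  exact EReal.bot_lt_zero.not_ge (hunb ▸ hmu.downlinkValue_nonneg (σ := σ) hγ)

end Duality

theorem proposition4p5_general {M KI : ℕ} (h : Fin KI → Fin M → ℂ) (σ γ : Fin KI → ℝ)
    (hγ : ∀ i, 0 < γ i) (G : Matrix (Fin M) (Fin M) ℂ) (β : ℝ)
    (hunb : downlinkValue h σ γ G β = ⊥)
    (lam0 : Fin KI → ℝ) (hlam0 : UplinkFeasible h γ G β lam0) :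
    ∃ n : ℕ,
      (∀ m < n, ∀ i : Fin KI,
        (uplinkMatrix h G β (fixedPointIter h γ G β lam0 m) i).PosSemidef ∧
        IsLeast (updateValues h γ G β (fixedPointIter h γ G β lam0 m) i)
          (fixedPointIter h γ G β lam0 (m + 1) i)) ∧
      ∃ i : Fin KI, ¬ (uplinkMatrix h G β (fixedPointIter h γ G β lam0 n) i).PosSemidef := by
  classical
  have hexit := hlam0.exists_not_posSemidef hγ hunb
  refine ⟨Nat.find hexit, fun m hm i => ?_, Nat.find_spec hexit⟩
  have hpos : (uplinkMatrix h G β (fixedPointIter h γ G β lam0 m) i).PosSemidef :=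
    not_not.mp (not_exists.mp (Nat.find_min hexit hm) i)
  exact ⟨hpos, isLeast_updateMap (hγ i).le hpos (hlam0.channel_ne_zero (hγ i))⟩

/-- If `β I - G` is not positive semidefinite and `g(β) = -∞`, then the fixed-point iteration, from
any feasible point of the dual uplink problem, reaches after finitely many steps a point `lam^(n)`
at which `∑_{k ≠ i} lam_k^(n) h_k^H h_k + β I - G` is not positive semidefinite for some `i`. All
the earlier steps are genuine: the minima that define the updates exist and are attained. -/
theorem proposition4p5 {M KI KE : ℕ}
    (h : Fin KI → Fin M → ℂ) (g : Fin KE → Fin M → ℂ)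
    (ζ : ℝ) (hζ0 : 0 < ζ) (hζ1 : ζ ≤ 1)
    (α : Fin KE → ℝ) (hα : ∀ j, 0 ≤ α j)
    (σ : Fin KI → ℝ) (hσ : ∀ i, 0 < σ i)
    (γ : Fin KI → ℝ) (hγ : ∀ i, 0 < γ i)
    (G : Matrix (Fin M) (Fin M) ℂ) (hG : G = energyMatrix ζ α g)
    (β : ℝ) (hβ : 0 ≤ β)
    (hnot : ¬ (noiseMatrix β G).PosSemidef)
    (hunb : downlinkValue h σ γ G β = ⊥)
    (lam0 : Fin KI → ℝ) (hlam0 : UplinkFeasible h γ G β lam0) :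
    ∃ n : ℕ,
      (∀ m < n, ∀ i : Fin KI,
        (uplinkMatrix h G β (fixedPointIter h γ G β lam0 m) i).PosSemidef ∧
        IsLeast (updateValues h γ G β (fixedPointIter h γ G β lam0 m) i)
          (fixedPointIter h γ G β lam0 (m + 1) i)) ∧
      ∃ i : Fin KI, ¬ (uplinkMatrix h G β (fixedPointIter h γ G β lam0 n) i).PosSemidef :=
  proposition4p5_general h σ γ hγ G β hunb lam0 hlam0
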